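/- Let $p$ and $\ell$ be distinct primes and let $N\ge 1$ be an integer with $\gcd(N,p\ell)=1$. Let $\mathrm{Rep}(N)$ be a set of representatives for the $\overline{\mathbb F}_p$-isomorphism classes of pairs $(E,P)$, where $E$ is a supersingular elliptic curve over $\overline{\mathbb F}_p$ and $P\in E(\overline{\mathbb F}_p)$ is a point of exact order $N$. Let $\Lambda_\ell(N)$ be the directed graph with vertex set $\mathrm{Rep}(N)$ in which the arrows from $(E,P)$ to $(E_1,P_1)$ are the orbits $\mathrm{Aut}(E_1,P_1)\circ\lambda$ of $\mathrm{Aut}(E_1,P_1)$ acting by composition on the set of isogenies $\lambda\colon E\to E_1$ of degree $\ell$ with $\lambda(P)=P_1$; the elements of the orbit are called the labels of the arrow. 1. If $N>4\ell^2$, then $\Lambda_\ell(N)$ is simple, i.e. there is no arrow from a vertex to itself and there is at most one arrow from any vertex to any other vertex; moreover, every arrow has exactly one label. 2. Without assuming $N>4\ell^2$, the girth of $\Lambda_\ell(N)$, i.e. the least length of a directed cycle (a closed walk of positive length in which no vertex repeats except that the last equals the first; $\infty$ if there is none), is at least $\log_\ell(N/4)$. -/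

import Mathlib

open scoped Polynomial.Bivariate ENNReal

/-! ### Directed graphs: cycles and girth -/

namespace Quiver

universe u v

/-- A cycle: a closed walk of positive length in which no vertex repeats, except that the last
vertex equals the first one. -/
def Path.IsDirectedCycle {V : Type u} [Quiver.{v} V] {a : V} (w : Path a a) : Prop :=
  0 < w.length ∧ w.vertices.tail.Nodup

/-- The girth of a directed graph: the least length of a cycle (`⊤` if there is no cycle). -/
noncomputable def girth (V : Type u) [Quiver.{v} V] : ℕ∞ :=
  ⨅ (a : V) (w : Path a a) (_ : w.IsDirectedCycle), (w.length : ℕ∞)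

end Quiver

/-! ### Isogenies of elliptic curves over a field -/

namespace WeierstrassCurve.Affine

variable {K : Type*} [Field K]

/-- The rational function `f` on `W` is regular at the point `(x, y)` and takes the value `c`
there: `f = g / h` with polynomials `g`, `h` such that `h(x, y) ≠ 0` and `g(x, y) / h(x, y) = c`. -/
def HasValueAt {W : Affine K} (f : W.FunctionField) (x y c : K) : Prop :=
  ∃ g h : K[X][Y], h.evalEval x y ≠ 0 ∧
    f * algebraMap W.CoordinateRing W.FunctionField (CoordinateRing.mk W h) =
      algebraMap W.CoordinateRing W.FunctionField (CoordinateRing.mk W g) ∧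
    g.evalEval x y / h.evalEval x y = c

/-- The coordinate function `x` on `W`. -/
noncomputable def coordX (W : Affine K) : W.FunctionField :=
  algebraMap W.CoordinateRing W.FunctionField (CoordinateRing.mk W (Polynomial.C Polynomial.X))

/-- The coordinate function `y` on `W`. -/
noncomputable def coordY (W : Affine K) : W.FunctionField :=
  algebraMap W.CoordinateRing W.FunctionField (CoordinateRing.mk W Polynomial.X)

variable [DecidableEq K] {W₁ W₂ : Affine K}

/-- The homomorphism `φ` on points is given by the embedding of function fields `F`
(`F` is `φ` acting by pullback): at all but finitely many points `(x, y)`, one has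
`φ (x, y) = (F(coordX)(x, y), F(coordY)(x, y))`. -/
def IsPullback (φ : W₁.Point →+ W₂.Point) (F : W₂.FunctionField →ₐ[K] W₁.FunctionField) : Prop :=
  ∀ᶠ P in Filter.cofinite, ∃ (x y x' y' : K) (h : W₁.Nonsingular x y) (h' : W₂.Nonsingular x' y'),
    P = .some x y h ∧ φ P = .some x' y' h' ∧
      HasValueAt (F W₂.coordX) x y x' ∧ HasValueAt (F W₂.coordY) x y y'

/-- `φ` is a (nonconstant) isogeny: a group homomorphism given by rational functions. Over an
algebraically closed field, an isogeny is determined by its action on points. -/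
def IsIsogeny (φ : W₁.Point →+ W₂.Point) : Prop :=
  ∃ F : W₂.FunctionField →ₐ[K] W₁.FunctionField, IsPullback φ F

/-- `φ` is an isogeny of degree `d`, the degree being that of the extension of function
fields `K(W₁) / φ^* K(W₂)`. -/
def IsIsogenyOfDegree (φ : W₁.Point →+ W₂.Point) (d : ℕ) : Prop :=
  ∃ F : W₂.FunctionField →ₐ[K] W₁.FunctionField, IsPullback φ F ∧
    Module.Finite F.fieldRange W₁.FunctionField ∧
    Module.finrank F.fieldRange W₁.FunctionField = d

/-- `φ` is an isomorphism of elliptic curves: an isogeny whose inverse is an isogeny. -/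
def IsIsomorphism (φ : W₁.Point ≃+ W₂.Point) : Prop :=
  IsIsogeny φ.toAddMonoidHom ∧ IsIsogeny φ.symm.toAddMonoidHom

/-- Over an algebraically closed field of characteristic `p`: `W` is supersingular, i.e. it has
no point of order `p`. -/
def IsSupersingular (W : Affine K) (p : ℕ) : Prop :=
  ∀ P : W.Point, p • P = 0 → P = 0

end WeierstrassCurve.Affine

/-! ### The supersingular graphs -/

open WeierstrassCurve.Affine

universe u

/-- An elliptic curve `E` with a point `P` on it. -/
structure PointedCurve (K : Type u) [Field K] where
  curve : WeierstrassCurve.Affine K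
  isElliptic : WeierstrassCurve.IsElliptic curve
  point : curve.Point

namespace PointedCurve

variable {K : Type u} [Field K] [DecidableEq K]

/-- `(E, P)` with `E` supersingular and `P` of exact order `N`. -/
def IsSupersingularOfLevel (p N : ℕ) (A : PointedCurve K) : Prop :=
  IsSupersingular A.curve p ∧ addOrderOf A.point = N

/-- `(E, P)` and `(E₁, P₁)` are isomorphic. -/
def Isomorphic (A B : PointedCurve K) : Prop :=
  ∃ e : A.curve.Point ≃+ B.curve.Point, IsIsomorphism e ∧ e A.point = B.point

/-- The set of automorphisms of `(E, P)`. -/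
def automorphisms (A : PointedCurve K) : Set (A.curve.Point ≃+ A.curve.Point) :=
  {e | IsIsomorphism e ∧ e A.point = A.point}

/-- The set of isogenies `(E, P) → (E₁, P₁)` of degree `ℓ`. -/
def isogenies (ℓ : ℕ) (A B : PointedCurve K) : Set (A.curve.Point →+ B.curve.Point) :=
  {f | IsIsogenyOfDegree f ℓ ∧ f A.point = B.point}

/-- The orbit `Aut(E₁, P₁) ∘ f` of a homomorphism `f : E → E₁`. -/
def orbit {A B : PointedCurve K} (f : A.curve.Point →+ B.curve.Point) :
    Set (A.curve.Point →+ B.curve.Point) :=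
  {g | ∃ e ∈ B.automorphisms, g = e.toAddMonoidHom.comp f}

/-- `R` is a choice of representatives for the isomorphism classes of pairs `(E, P)` with `E`
supersingular in characteristic `p` and `P` of order `N`. -/
def IsSystemOfRepresentatives (p N : ℕ) (R : Set (PointedCurve K)) : Prop :=
  (∀ A ∈ R, A.IsSupersingularOfLevel p N) ∧
    ∀ A : PointedCurve K, A.IsSupersingularOfLevel p N → ∃! B, B ∈ R ∧ A.Isomorphic B

end PointedCurve

/-- The vertices of the supersingular graph: the chosen representatives. The arguments `R`
and `ℓ` determine the arrows. -/
structure SupersingularGraph {K : Type u} [Field K] (R : Set (PointedCurve K)) (ℓ : ℕ) where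
  val : PointedCurve K
  mem : val ∈ R

namespace SupersingularGraph

variable {K : Type u} [Field K] [DecidableEq K] {R : Set (PointedCurve K)} {ℓ : ℕ}

/-- An arrow from `(E, P)` to `(E₁, P₁)`: an orbit of `Aut(E₁, P₁)` on the set of isogenies
`(E, P) → (E₁, P₁)` of degree `ℓ`. The elements of the orbit are the labels of the arrow. -/
structure Arrow (A B : SupersingularGraph R ℓ) where
  labels : Set (A.val.curve.Point →+ B.val.curve.Point)
  isOrbit : ∃ f ∈ PointedCurve.isogenies ℓ A.val B.val, labels = PointedCurve.orbit f

instance : Quiver (SupersingularGraph R ℓ) where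
  Hom A B := Arrow A B

/-- The set of labels of an arrow. -/
def labels {A B : SupersingularGraph R ℓ} (a : A ⟶ B) :
    Set (A.val.curve.Point →+ B.val.curve.Point) :=
  Arrow.labels a

end SupersingularGraph

/-! ### Degrees over simple transcendental subextensions -/

section FieldDegree

open Polynomial IntermediateField

variable {K L : Type*} [Field K] [Field L] [Algebra K L]

/-- The embedding of `K[X]` into `K⟮f⟯` sending `X` to `f`. -/
noncomputable def polynomialToAdjoin (f : L) : K[X] →ₐ[K] K⟮f⟯ :=
  aeval (AdjoinSimple.gen K f)

lemma algebraMap_polynomialToAdjoin (f : L) (q : K[X]) :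
    algebraMap K⟮f⟯ L (polynomialToAdjoin f q) = aeval f q := by
  rw [polynomialToAdjoin, ← aeval_algebraMap_apply, AdjoinSimple.algebraMap_gen]

lemma polynomialToAdjoin_injective {f : L} (hf : Transcendental K f) :
    Function.Injective (polynomialToAdjoin (K := K) f) := by
  intro a b hab
  apply transcendental_iff_injective.1 hf
  rw [← algebraMap_polynomialToAdjoin, hab, algebraMap_polynomialToAdjoin]

lemma isFractionRing_polynomialToAdjoin {f : L} (hf : Transcendental K f) :
    @IsFractionRing K[X] _ K⟮f⟯ _ (polynomialToAdjoin (K := K) f).toRingHom.toAlgebra := by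
  let _ := (polynomialToAdjoin (K := K) f).toRingHom.toAlgebra
  have : FaithfulSMul K[X] K⟮f⟯ :=
    (faithfulSMul_iff_algebraMap_injective _ _).2 (polynomialToAdjoin_injective hf)
  refine IsFractionRing.of_field _ _ fun z ↦ ?_
  obtain ⟨r, s, h⟩ := (mem_adjoin_simple_iff K (z : L)).1 z.2
  refine ⟨r, s, Subtype.ext ?_⟩
  rw [h, ← algebraMap_polynomialToAdjoin, ← algebraMap_polynomialToAdjoin]
  rfl

lemma aeval_map_polynomialToAdjoin (f g : L) (Φ : K[X][Y]) :
    aeval g (Φ.map (polynomialToAdjoin f : K[X] →ₐ[K] K⟮f⟯).toRingHom) = Φ.aevalAeval f g := by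
  induction Φ using Polynomial.induction_on' with
  | add p q hp hq => simp only [Polynomial.map_add, map_add, hp, hq]
  | monomial n a =>
    rw [map_monomial, aeval_monomial, ← C_mul_X_pow_eq_monomial, map_mul, map_pow, aevalAeval_Y,
      aevalAeval_C]
    congr 1
    exact algebraMap_polynomialToAdjoin f a

lemma map_polynomialToAdjoin_ne_zero {f : L} (hf : Transcendental K f) {Φ : K[X][Y]}
    (hΦ : Φ ≠ 0) : Φ.map (polynomialToAdjoin f : K[X] →ₐ[K] K⟮f⟯).toRingHom ≠ 0 :=
  (Polynomial.map_ne_zero_iff (polynomialToAdjoin_injective hf)).2 hΦ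

lemma isIntegral_adjoin_of_aevalAeval_eq_zero {f g : L} (hf : Transcendental K f) {Φ : K[X][Y]}
    (hΦ : Φ ≠ 0) (h : Φ.aevalAeval f g = 0) : IsIntegral K⟮f⟯ g :=
  IsAlgebraic.isIntegral
    ⟨_, map_polynomialToAdjoin_ne_zero hf hΦ, (aeval_map_polynomialToAdjoin f g Φ).trans h⟩

lemma natDegree_minpoly_adjoin_le {f g : L} (hf : Transcendental K f) {Φ : K[X][Y]} (hΦ : Φ ≠ 0)
    (h : Φ.aevalAeval f g = 0) : (minpoly K⟮f⟯ g).natDegree ≤ Φ.natDegree :=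
  (natDegree_le_natDegree (minpoly.degree_le_of_ne_zero _ _ (map_polynomialToAdjoin_ne_zero hf hΦ)
    ((aeval_map_polynomialToAdjoin f g Φ).trans h))).trans natDegree_map_le

/-- By the Gauss lemma, an irreducible equation between `f` and `g` has the degree of the minimal
polynomial of `g` over `K⟮f⟯`. -/
lemma natDegree_eq_natDegree_minpoly {f g : L} (hf : Transcendental K f) {Φ : K[X][Y]}
    (hΦ : Irreducible Φ) (h : Φ.aevalAeval f g = 0) :
    Φ.natDegree = (minpoly K⟮f⟯ g).natDegree := by
  let _ := (polynomialToAdjoin (K := K) f).toRingHom.toAlgebra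
  have := isFractionRing_polynomialToAdjoin hf
  have hdeg : Φ.natDegree ≠ 0 := by
    intro h0
    obtain ⟨q, rfl⟩ := natDegree_eq_zero.1 h0
    rw [aevalAeval_C] at h
    have := (transcendental_iff.1 hf) q h
    exact hΦ.ne_zero (by rw [this, map_zero])
  have hirr : Irreducible (Φ.map (algebraMap K[X] K⟮f⟯)) :=
    (IsPrimitive.irreducible_iff_irreducible_map_fraction_map (hΦ.isPrimitive hdeg)).1 hΦ
  have h0 : aeval g (Φ.map (algebraMap K[X] K⟮f⟯)) = 0 :=
    (aeval_map_polynomialToAdjoin f g Φ).trans h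
  rw [← minpoly.eq_of_irreducible hirr h0, natDegree_mul_C, natDegree_map_eq_of_injective]
  · exact polynomialToAdjoin_injective hf
  · exact inv_ne_zero (leadingCoeff_ne_zero.2 hirr.ne_zero)

lemma finrank_adjoin_simple_eq {f g : L} (hg : IsIntegral K⟮f⟯ g) :
    Module.finrank K⟮f⟯ L =
      (minpoly K⟮f⟯ g).natDegree * Module.finrank (adjoin K {f, g}) L := by
  have hle : K⟮f⟯ ≤ adjoin K {f, g} := adjoin.mono _ _ _ (by simp)
  rw [← relfinrank_mul_finrank_top hle, relfinrank_eq_finrank_of_le hle]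
  congr 1
  have : extendScalars hle = K⟮f⟯⟮g⟯ := by
    apply restrictScalars_injective K
    rw [extendScalars_restrictScalars, adjoin_simple_adjoin_simple]
  rw [this, adjoin.finrank hg]

lemma exists_irreducible_aevalAeval_eq_zero {f g : L} (hf : Transcendental K f)
    (hg : IsAlgebraic K⟮f⟯ g) : ∃ Φ : K[X][Y], Irreducible Φ ∧ Φ.aevalAeval f g = 0 := by
  let _ := (polynomialToAdjoin (K := K) f).toRingHom.toAlgebra
  let _ : Algebra K[X] L := (aeval f).toRingHom.toAlgebra
  have := isFractionRing_polynomialToAdjoin hf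
  have : IsScalarTower K[X] K⟮f⟯ L := .of_algebraMap_eq fun q ↦
    (algebraMap_polynomialToAdjoin f q).symm
  obtain ⟨Φ, hΦ, h⟩ := (IsFractionRing.isAlgebraic_iff K[X] K⟮f⟯ L).2 hg
  let I : Ideal K[X][Y] := RingHom.ker (aevalAeval (R := K) f g)
  have hI : I.IsPrime := RingHom.ker_isPrime _
  have hmem : Φ ∈ I := by
    rw [RingHom.mem_ker, ← aeval_map_polynomialToAdjoin, ← h]
    exact aeval_map_algebraMap K⟮f⟯ g Φ
  obtain ⟨Ψ, hΨ, hp⟩ := hI.exists_mem_prime_of_ne_bot (fun h0 ↦ hΦ (by simpa [h0] using hmem))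
  exact ⟨Ψ, hp.irreducible, hΨ⟩

lemma coeff_coeff_swap {R : Type*} [CommRing R] (Φ : R[X][Y]) (i j : ℕ) :
    ((Bivariate.swap Φ).coeff j).coeff i = (Φ.coeff i).coeff j := by
  induction Φ using Polynomial.induction_on' with
  | add p q hp hq => simp only [map_add, coeff_add, hp, hq]
  | monomial n a =>
    induction a using Polynomial.induction_on' with
    | add p q hp hq => simp only [map_add, coeff_add, hp, hq]
    | monomial m r =>
      rw [Bivariate.swap_monomial_monomial, coeff_monomial, coeff_monomial]
      split_ifs with h₁ h₂ h₂ <;> simp [coeff_monomial, h₁, h₂]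

lemma natDegree_coeff_le_natDegree_swap {R : Type*} [CommRing R] (Φ : R[X][Y]) (i : ℕ) :
    (Φ.coeff i).natDegree ≤ (Bivariate.swap Φ).natDegree := by
  refine natDegree_le_iff_coeff_eq_zero.2 fun j hj ↦ ?_
  rw [← coeff_coeff_swap, coeff_eq_zero_of_natDegree_lt hj, coeff_zero]

/-- The substitution `X ↦ X + Y`. -/
noncomputable def shear (Φ : K[X][Y]) : K[X][Y] :=
  Φ.aevalAeval (C X + Y) Y

lemma aevalAeval_shear {A : Type*} [CommRing A] [Algebra K A] (Φ : K[X][Y]) (f g : A) :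
    (shear Φ).aevalAeval f g = Φ.aevalAeval (f + g) g := by
  have : (aevalAeval f g).comp (aevalAeval (R := K) (C X + Y : K[X][Y]) Y) =
      aevalAeval (R := K) (f + g) g := by
    apply (aevalAevalEquiv K A).symm.injective
    simp [aevalAevalEquiv]
  exact DFunLike.congr_fun this Φ

lemma shear_ne_zero {Φ : K[X][Y]} (hΦ : Φ ≠ 0) : shear Φ ≠ 0 := by
  intro h
  have h₁ := aevalAeval_shear Φ (C X - Y : K[X][Y]) Y
  have h₂ : aevalAeval (R := K) (C X : K[X][Y]) Y = AlgHom.id K _ := by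
    apply (aevalAevalEquiv K _).symm.injective
    simp [aevalAevalEquiv]
  rw [sub_add_cancel, h₂, h, map_zero] at h₁
  exact hΦ h₁.symm

lemma natDegree_shear_le (Φ : K[X][Y]) :
    (shear Φ).natDegree ≤ Φ.natDegree + (Bivariate.swap Φ).natDegree := by
  have : shear Φ = ∑ i ∈ Finset.range (Φ.natDegree + 1),
      aeval (C X + Y : K[X][Y]) (Φ.coeff i) * Y ^ i := by
    conv_lhs => rw [shear, Φ.as_sum_range_C_mul_X_pow, map_sum]
    simp only [map_mul, map_pow, aevalAeval_Y, aevalAeval_C]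
  rw [this]
  refine natDegree_sum_le_of_forall_le _ _ fun i hi ↦ ?_
  refine natDegree_mul_le.trans ?_
  rw [natDegree_X_pow, add_comm]
  refine add_le_add (Nat.lt_succ_iff.1 (Finset.mem_range.1 hi)) ?_
  refine le_trans ?_ (natDegree_coeff_le_natDegree_swap Φ i)
  rw [aeval_eq_sum_range]
  refine natDegree_sum_le_of_forall_le _ _ fun k hk ↦ ?_
  refine (natDegree_smul_le _ _).trans (natDegree_pow_le.trans ?_)
  have : (C X + Y : K[X][Y]).natDegree ≤ 1 := by compute_degree
  have := Nat.lt_succ_iff.1 (Finset.mem_range.1 hk)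
  nlinarith

lemma transcendental_of_finiteDimensional {f h : L} [FiniteDimensional K⟮f⟯ L]
    (hh : Transcendental K h) : Transcendental K f := by
  intro hf
  have := isAlgebraic_adjoin_simple hf.isIntegral
  have := Algebra.IsAlgebraic.trans K K⟮f⟯ L
  exact hh (Algebra.IsAlgebraic.isAlgebraic h)

/-- The degree of a function is subadditive. -/
theorem finrank_adjoin_sub_le (f g : L) [FiniteDimensional K⟮f⟯ L] [FiniteDimensional K⟮g⟯ L]
    (h : Transcendental K (f - g)) : FiniteDimensional K⟮f - g⟯ L ∧
      Module.finrank K⟮f - g⟯ L ≤ Module.finrank K⟮f⟯ L + Module.finrank K⟮g⟯ L := by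
  have hf : Transcendental K f := transcendental_of_finiteDimensional h
  have hg : Transcendental K g := transcendental_of_finiteDimensional h
  have hgf : IsIntegral K⟮f⟯ g := IsIntegral.of_finite _ _
  have hfg : IsIntegral K⟮g⟯ f := IsIntegral.of_finite _ _
  obtain ⟨Φ, hΦ, h0⟩ := exists_irreducible_aevalAeval_eq_zero hf hgf.isAlgebraic
  have h0' : (Bivariate.swap Φ).aevalAeval g f = 0 := by
    rwa [Bivariate.aevalAeval_swap]
  have hΦ' : Irreducible (Bivariate.swap Φ) :=
    (MulEquiv.irreducible_iff (Bivariate.swap (R := K))).2 hΦ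
  have hs : (shear Φ).aevalAeval (f - g) g = 0 := by
    rwa [aevalAeval_shear, sub_add_cancel]
  have hgh := isIntegral_adjoin_of_aevalAeval_eq_zero h (shear_ne_zero hΦ.ne_zero) hs
  have hle := natDegree_minpoly_adjoin_le h (shear_ne_zero hΦ.ne_zero) hs
  have e₁ := finrank_adjoin_simple_eq hgf
  have e₂ := finrank_adjoin_simple_eq hfg
  have e₃ := finrank_adjoin_simple_eq hgh
  have hM : adjoin K {f - g, g} = adjoin K {f, g} := by
    apply le_antisymm <;> rw [adjoin_le_iff, Set.insert_subset_iff, Set.singleton_subset_iff]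
    · exact ⟨sub_mem (subset_adjoin _ _ (by simp)) (subset_adjoin _ _ (by simp)),
        subset_adjoin _ _ (by simp)⟩
    · refine ⟨?_, subset_adjoin _ _ (by simp)⟩
      have := add_mem (subset_adjoin K {f - g, g} (by simp : f - g ∈ _))
        (subset_adjoin K {f - g, g} (by simp : g ∈ _))
      rwa [sub_add_cancel] at this
  rw [Set.pair_comm g f] at e₂
  rw [hM] at e₃
  rw [← natDegree_eq_natDegree_minpoly hf hΦ h0] at e₁
  rw [← natDegree_eq_natDegree_minpoly hg hΦ' h0'] at e₂
  constructor
  · apply FiniteDimensional.of_finrank_pos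
    rw [e₃]
    have h₁ : 0 < Module.finrank K⟮f⟯ L := Module.finrank_pos
    rw [e₁] at h₁
    exact Nat.mul_pos (minpoly.natDegree_pos hgh) (Nat.pos_of_mul_pos_left h₁)
  · rw [e₁, e₂, e₃, ← add_mul]
    exact Nat.mul_le_mul_right _ (hle.trans (natDegree_shear_le Φ))

lemma linearIndependent_adjoin_simple {ι : Type*} {f : L} (hf : Transcendental K f) {v : ι → L}
    (h : ∀ (s : Finset ι) (q : ι → K[X]), ∑ i ∈ s, aeval f (q i) * v i = 0 → ∀ i ∈ s, q i = 0) :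
    LinearIndependent K⟮f⟯ v := by
  let _ := (polynomialToAdjoin (K := K) f).toRingHom.toAlgebra
  let _ : Algebra K[X] L := (aeval f).toRingHom.toAlgebra
  have := isFractionRing_polynomialToAdjoin hf
  have : IsScalarTower K[X] K⟮f⟯ L := .of_algebraMap_eq fun q ↦
    (algebraMap_polynomialToAdjoin f q).symm
  rw [← LinearIndependent.iff_fractionRing (R := K[X]), linearIndependent_iff']
  exact fun s q hq ↦ h s q hq

end FieldDegree

/-! ### Values of rational functions -/

namespace WeierstrassCurve.Affine

open Polynomial IntermediateField

variable {K : Type*} [Field K] {W : Affine K}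

lemma evalEval_eq_of_mk_eq {x y : K} (h : W.Equation x y) {g₁ g₂ : K[X][Y]}
    (hg : CoordinateRing.mk W g₁ = CoordinateRing.mk W g₂) : g₁.evalEval x y = g₂.evalEval x y := by
  rw [← AdjoinRoot.evalEval_mk h, ← AdjoinRoot.evalEval_mk h]
  exact congrArg _ hg

/-- A polynomial in the coordinates, as a rational function on the curve. -/
noncomputable def polyFun (W : Affine K) : K[X][Y] →+* W.FunctionField :=
  (algebraMap W.CoordinateRing W.FunctionField).comp (CoordinateRing.mk W)

lemma polyFun_eq_aevalAeval (g : K[X][Y]) : polyFun W g = g.aevalAeval W.coordX W.coordY := by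
  let φ : K[X][Y] →ₐ[K] W.FunctionField := { polyFun W with commutes' := fun _ ↦ rfl }
  have : φ = aevalAeval W.coordX W.coordY := by
    apply (aevalAevalEquiv K _).symm.injective
    simp only [Equiv.symm_apply_apply, aevalAevalEquiv_symm_apply]
    rfl
  exact DFunLike.congr_fun this g

lemma polyFun_eq_iff {g₁ g₂ : K[X][Y]} :
    polyFun W g₁ = polyFun W g₂ ↔ CoordinateRing.mk W g₁ = CoordinateRing.mk W g₂ :=
  (IsFractionRing.injective W.CoordinateRing W.FunctionField).eq_iff

lemma exists_mul_polyFun_eq (f : W.FunctionField) :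
    ∃ g h : K[X][Y], polyFun W h ≠ 0 ∧ f * polyFun W h = polyFun W g := by
  obtain ⟨a, b, hb, rfl⟩ := IsFractionRing.div_surjective (A := W.CoordinateRing) f
  obtain ⟨g, rfl⟩ := AdjoinRoot.mk_surjective a
  obtain ⟨h, rfl⟩ := AdjoinRoot.mk_surjective b
  have h0 : polyFun W h ≠ 0 := by
    rw [← map_zero (polyFun W), ne_eq, polyFun_eq_iff, map_zero]
    exact nonZeroDivisors.ne_zero hb
  exact ⟨g, h, h0, div_mul_cancel₀ _ h0⟩

section HasValueAt

variable {f f₁ f₂ : W.FunctionField} {x y c c₁ c₂ : K}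

lemma hasValueAt_iff : HasValueAt f x y c ↔ ∃ g h : K[X][Y], h.evalEval x y ≠ 0 ∧
    f * polyFun W h = polyFun W g ∧ g.evalEval x y = c * h.evalEval x y := by
  refine exists_congr fun g ↦ exists_congr fun h ↦ and_congr_right fun h0 ↦
    and_congr_right fun _ ↦ div_eq_iff h0

lemma HasValueAt.unique (hxy : W.Equation x y) (h₁ : HasValueAt f x y c₁)
    (h₂ : HasValueAt f x y c₂) : c₁ = c₂ := by
  obtain ⟨g, h, h0, e, v⟩ := hasValueAt_iff.1 h₁
  obtain ⟨g', h', h0', e', v'⟩ := hasValueAt_iff.1 h₂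
  have : polyFun W (g * h') = polyFun W (g' * h) := by
    rw [map_mul, map_mul, ← e, ← e']; ring
  have := evalEval_eq_of_mk_eq hxy (polyFun_eq_iff.1 this)
  rw [evalEval_mul, evalEval_mul, v, v'] at this
  have : (c₁ - c₂) * (h.evalEval x y * h'.evalEval x y) = 0 := by linear_combination this
  exact sub_eq_zero.1 ((mul_eq_zero.1 this).resolve_right (mul_ne_zero h0 h0'))

lemma HasValueAt.add (h₁ : HasValueAt f₁ x y c₁) (h₂ : HasValueAt f₂ x y c₂) :
    HasValueAt (f₁ + f₂) x y (c₁ + c₂) := by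
  obtain ⟨g, h, h0, e, v⟩ := hasValueAt_iff.1 h₁
  obtain ⟨g', h', h0', e', v'⟩ := hasValueAt_iff.1 h₂
  refine hasValueAt_iff.2 ⟨g * h' + g' * h, h * h', ?_, ?_, ?_⟩
  · rw [evalEval_mul]; exact mul_ne_zero h0 h0'
  · simp only [map_mul, map_add, ← e, ← e']; ring
  · simp only [evalEval_mul, evalEval_add, v, v']; ring

lemma HasValueAt.mul (h₁ : HasValueAt f₁ x y c₁) (h₂ : HasValueAt f₂ x y c₂) :
    HasValueAt (f₁ * f₂) x y (c₁ * c₂) := by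
  obtain ⟨g, h, h0, e, v⟩ := hasValueAt_iff.1 h₁
  obtain ⟨g', h', h0', e', v'⟩ := hasValueAt_iff.1 h₂
  refine hasValueAt_iff.2 ⟨g * g', h * h', ?_, ?_, ?_⟩
  · rw [evalEval_mul]; exact mul_ne_zero h0 h0'
  · simp only [map_mul, ← e, ← e']; ring
  · simp only [evalEval_mul, v, v']; ring

lemma hasValueAt_polyFun (g : K[X][Y]) : HasValueAt (polyFun W g) x y (g.evalEval x y) :=
  hasValueAt_iff.2 ⟨g, 1, by simp, by simp, by simp⟩

lemma hasValueAt_algebraMap (c : K) : HasValueAt (algebraMap K W.FunctionField c) x y c := by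
  have := hasValueAt_polyFun (W := W) (x := x) (y := y) (C (C c))
  rwa [evalEval_C, eval_C] at this

lemma hasValueAt_coordX : HasValueAt W.coordX x y x := by
  have := hasValueAt_polyFun (W := W) (x := x) (y := y) (C X)
  rwa [evalEval_C, eval_X] at this

lemma hasValueAt_coordY : HasValueAt W.coordY x y y := by
  have := hasValueAt_polyFun (W := W) (x := x) (y := y) Y
  rwa [evalEval_X] at this

lemma HasValueAt.neg (h : HasValueAt f x y c) : HasValueAt (-f) x y (-c) := by
  have := (hasValueAt_algebraMap (W := W) (x := x) (y := y) (-1)).mul h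
  rwa [map_neg, map_one, neg_one_mul, neg_one_mul] at this

lemma HasValueAt.sub (h₁ : HasValueAt f₁ x y c₁) (h₂ : HasValueAt f₂ x y c₂) :
    HasValueAt (f₁ - f₂) x y (c₁ - c₂) := by
  simpa only [sub_eq_add_neg] using h₁.add h₂.neg

lemma HasValueAt.pow (h : HasValueAt f x y c) (n : ℕ) : HasValueAt (f ^ n) x y (c ^ n) := by
  induction n with
  | zero => simpa using hasValueAt_algebraMap (W := W) (x := x) (y := y) 1
  | succ n ih => simpa only [pow_succ] using ih.mul h

lemma HasValueAt.sum {ι : Type*} (s : Finset ι) {f : ι → W.FunctionField} {c : ι → K}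
    (h : ∀ i ∈ s, HasValueAt (f i) x y (c i)) : HasValueAt (∑ i ∈ s, f i) x y (∑ i ∈ s, c i) := by
  classical
  induction s using Finset.induction_on with
  | empty => simpa using hasValueAt_algebraMap (W := W) (x := x) (y := y) 0
  | insert i s hi ih =>
    rw [Finset.sum_insert hi, Finset.sum_insert hi]
    exact (h i (by simp)).add (ih fun j hj ↦ h j (by simp [hj]))

/-- Values may be computed from an equation `f * f₁ = f₂` with `f₁` not vanishing. -/
lemma HasValueAt.of_mul_eq (h₁ : HasValueAt f₁ x y c₁) (h₂ : HasValueAt f₂ x y c₂) (h0 : c₁ ≠ 0)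
    (e : f * f₁ = f₂) (hc : c * c₁ = c₂) : HasValueAt f x y c := by
  obtain ⟨g, h, h0', e', v⟩ := hasValueAt_iff.1 h₁
  obtain ⟨g', h', h0'', e'', v'⟩ := hasValueAt_iff.1 h₂
  refine hasValueAt_iff.2 ⟨g' * h, g * h', ?_, ?_, ?_⟩
  · rw [evalEval_mul, v]; exact mul_ne_zero (mul_ne_zero h0 h0') h0''
  · simp only [map_mul, ← e', ← e'', ← e]; ring
  · simp only [evalEval_mul, v, v', ← hc]; ring

lemma HasValueAt.div (h₁ : HasValueAt f₁ x y c₁) (h₂ : HasValueAt f₂ x y c₂)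
    (hxy : W.Equation x y) (h0 : c₂ ≠ 0) : HasValueAt (f₁ / f₂) x y (c₁ / c₂) := by
  have : f₂ ≠ 0 := by
    rintro rfl
    have h := hasValueAt_algebraMap (W := W) (x := x) (y := y) 0
    rw [map_zero] at h
    exact h0 (h₂.unique hxy h)
  exact h₂.of_mul_eq h₁ h0 (div_mul_cancel₀ _ this) (div_mul_cancel₀ _ h0)

lemma HasValueAt.aeval (h : HasValueAt f x y c) (q : K[X]) :
    HasValueAt (aeval f q) x y (q.eval c) := by
  rw [aeval_eq_sum_range, eval_eq_sum_range]
  refine HasValueAt.sum _ fun i _ ↦ ?_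
  rw [Algebra.smul_def]
  exact (hasValueAt_algebraMap _).mul (h.pow i)

lemma HasValueAt.aevalAeval (h₁ : HasValueAt f₁ x y c₁) (h₂ : HasValueAt f₂ x y c₂) (g : K[X][Y]) :
    HasValueAt (g.aevalAeval f₁ f₂) x y (g.evalEval c₁ c₂) := by
  rw [g.as_sum_range_C_mul_X_pow, map_sum, evalEval_finsetSum]
  refine HasValueAt.sum _ fun i _ ↦ ?_
  rw [map_mul, map_pow, aevalAeval_C, aevalAeval_Y, evalEval_mul, evalEval_pow, evalEval_X,
    evalEval_C]
  exact (h₁.aeval _).mul (h₂.pow i)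

end HasValueAt

lemma finite_setOf_equation (W : Affine K) (x : K) : {y : K | W.Equation x y}.Finite := by
  have h0 : W.polynomial.map (evalRingHom x) ≠ 0 := (W.monic_polynomial.map _).ne_zero
  refine (Polynomial.finite_setOfPred_isRoot h0).subset fun y hy ↦ ?_
  rw [Set.mem_ofPred_eq, IsRoot, map_evalRingHom_eval]
  exact hy

/-- A nonzero rational function has finitely many zeros. -/
lemma finite_zeros {f : W.FunctionField} (hf : f ≠ 0) :
    {t : K × K | W.Equation t.1 t.2 ∧ HasValueAt f t.1 t.2 0}.Finite := by
  obtain ⟨g, h, h0, e⟩ := exists_mul_polyFun_eq f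
  have hg : CoordinateRing.mk W g ≠ 0 := by
    intro hg
    have : polyFun W g = 0 := by rw [← map_zero (polyFun W), polyFun_eq_iff, hg, map_zero]
    exact mul_ne_zero hf h0 (e.trans this)
  obtain ⟨p, q, hpq⟩ := CoordinateRing.exists_smul_basis_eq (CoordinateRing.mk W g)
  obtain ⟨n, g', hn, hg'⟩ : ∃ (n : K[X]) (g' : K[X][Y]), n ≠ 0 ∧
      CoordinateRing.mk W (C n) = CoordinateRing.mk W (g * g') := by
    refine ⟨Algebra.norm K[X] (CoordinateRing.mk W g),
      C p + C q * (-(Y : K[X][Y]) - C (C W.a₁ * X + C W.a₃)), ?_, ?_⟩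
    · rwa [ne_eq, Algebra.norm_eq_zero_iff_of_basis (CoordinateRing.basis W)]
    · have hgpq : CoordinateRing.mk W g = CoordinateRing.mk W (C p + C q * Y) := by
        rw [← hpq, CoordinateRing.smul, CoordinateRing.smul, mul_one, map_add, map_mul]
      rw [map_mul, hgpq, ← map_mul, ← hgpq, ← hpq]
      exact CoordinateRing.coe_norm_smul_basis p q
  refine ((Polynomial.finite_setOfPred_isRoot hn).biUnion fun x _ ↦
    (finite_setOf_equation W x).image (Prod.mk x)).subset fun t ⟨ht, hv⟩ ↦ ?_
  have hgt : g.evalEval t.1 t.2 = 0 := by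
    have h₁ := hv.mul (hasValueAt_polyFun h)
    rw [e, zero_mul] at h₁
    exact (hasValueAt_polyFun g).unique ht h₁
  have := evalEval_eq_of_mk_eq ht hg'
  rw [evalEval_mul, hgt, zero_mul, evalEval_C] at this
  exact Set.mem_biUnion (show t.1 ∈ {x | IsRoot n x} from this) ⟨t.2, ht, rfl⟩

/-- The number of points where a function of degree `d` takes a given value is at most `d`. -/
theorem card_le_finrank_adjoin {f : W.FunctionField} (hf : Transcendental K f)
    [FiniteDimensional K⟮f⟯ W.FunctionField] (c : K) (S : Finset (K × K))
    (hS : ∀ t ∈ S, W.Equation t.1 t.2 ∧ HasValueAt f t.1 t.2 c) :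
    S.card ≤ Module.finrank K⟮f⟯ W.FunctionField := by
  classical
  have hsep : ∀ t u : K × K, t ≠ u → ∃ g : K[X][Y], g.evalEval t.1 t.2 ≠ 0 ∧
      g.evalEval u.1 u.2 = 0 := by
    intro t u htu
    by_cases h : t.1 = u.1
    · refine ⟨Y - C (C u.2), ?_, by simp⟩
      simpa [sub_eq_zero] using fun h' ↦ htu (Prod.ext h h')
    · exact ⟨C (X - C u.1), by simpa only [evalEval_C, eval_sub, eval_X, eval_C, sub_ne_zero] using h,
        by simp only [evalEval_C, eval_sub, eval_X, eval_C, sub_self]⟩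
  choose! g hg₁ hg₂ using hsep
  let e : S → W.FunctionField := fun t ↦ polyFun W (∏ u ∈ S.erase t, g t u)
  have he : ∀ t u : S, t ≠ u → HasValueAt (e t) u.1.1 u.1.2 0 := by
    intro t u htu
    have hv := hasValueAt_polyFun (W := W) (x := u.1.1) (y := u.1.2) (∏ u ∈ S.erase t, g t u)
    have h0 : ∏ v ∈ S.erase t, (g t v).evalEval u.1.1 u.1.2 = 0 :=
      Finset.prod_eq_zero (i := (u : K × K)) (by simpa using fun h ↦ htu h.symm)
        (hg₂ _ _ fun h ↦ htu (Subtype.ext h))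
    rwa [evalEval_prod, h0] at hv
  have he' : ∀ t : S, ∃ a ≠ 0, HasValueAt (e t) t.1.1 t.1.2 a := by
    intro t
    refine ⟨_, ?_, hasValueAt_polyFun _⟩
    rw [evalEval_prod, Finset.prod_ne_zero_iff]
    exact fun u hu ↦ hg₁ _ _ (Finset.ne_of_mem_erase hu).symm
  have key : ∀ (k : ℕ) (q : S → K[X]), ∑ t, aeval f (q t) * e t = 0 →
      ∀ t, (X - C c) ^ k ∣ q t := by
    intro k
    induction k with
    | zero => simp
    | succ k ih =>
      intro q hq
      have hroot : ∀ u, X - C c ∣ q u := by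
        intro u
        obtain ⟨a, ha, hv⟩ := he' u
        have hsum : HasValueAt (∑ t, aeval f (q t) * e t) u.1.1 u.1.2
            (∑ t, (q t).eval c * (if t = u then a else 0)) := by
          refine HasValueAt.sum _ fun t _ ↦ ((hS u u.2).2.aeval _).mul ?_
          split_ifs with h
          · rwa [h]
          · exact he _ _ h
        rw [hq] at hsum
        have h0 := hasValueAt_algebraMap (W := W) (x := u.1.1) (y := u.1.2) 0
        rw [map_zero] at h0
        have := hsum.unique (hS u u.2).1 h0
        simp only [mul_ite, mul_zero, Finset.sum_ite_eq', Finset.mem_univ, if_true] at this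
        exact dvd_iff_isRoot.2 ((mul_eq_zero.1 this).resolve_right ha)
      choose r hr using hroot
      have hfc : f - algebraMap K _ c ≠ 0 := fun h ↦
        hf (by rw [sub_eq_zero.1 h]; exact isAlgebraic_algebraMap c)
      have hr0 : ∑ t, aeval f (r t) * e t = 0 := by
        refine (mul_eq_zero.1 ?_).resolve_left hfc
        rw [← hq, Finset.mul_sum]
        refine Finset.sum_congr rfl fun t _ ↦ ?_
        rw [hr t, map_mul, map_sub, aeval_X, aeval_C, mul_assoc]
      intro t
      rw [hr t, pow_succ']
      exact mul_dvd_mul_left _ (ih r hr0 t)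
  have hli : LinearIndependent K⟮f⟯ e := by
    refine linearIndependent_adjoin_simple hf fun s q hq t ht ↦ ?_
    let q' : S → K[X] := fun t ↦ if t ∈ s then q t else 0
    have hq' : ∑ t, aeval f (q' t) * e t = 0 := by
      rw [← hq, ← Finset.sum_subset (Finset.subset_univ s)]
      · exact Finset.sum_congr rfl fun u hu ↦ by simp [q', hu]
      · intro u _ hu
        simp [q', hu]
    have hd := key ((q t).natDegree + 1) q' hq' t
    simp only [q', ht, if_true] at hd
    by_contra h0
    have := natDegree_le_of_dvd hd h0
    rw [natDegree_pow, natDegree_X_sub_C] at this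
    omega
  simpa using hli.fintype_card_le_finrank

end WeierstrassCurve.Affine

/-! ### Pullbacks of isogenies -/

namespace WeierstrassCurve.Affine

open Polynomial IntermediateField

variable {K : Type*} [Field K] {W W₁ W₂ W₃ : Affine K}

lemma aevalAeval_mem_of_mem {L : Type*} [Field L] [Algebra K L] {M : IntermediateField K L}
    {a b : L} (ha : a ∈ M) (hb : b ∈ M) (g : K[X][Y]) : g.aevalAeval a b ∈ M := by
  rw [g.as_sum_range_C_mul_X_pow, map_sum]
  refine sum_mem fun i _ ↦ ?_
  rw [map_mul, map_pow, aevalAeval_C, aevalAeval_Y]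
  refine mul_mem ?_ (pow_mem hb i)
  rw [aeval_eq_sum_range]
  exact sum_mem fun k _ ↦ M.smul_mem (pow_mem ha k)

lemma adjoin_coord (W : Affine K) : adjoin K {W.coordX, W.coordY} = ⊤ := by
  refine eq_top_iff.2 fun f _ ↦ ?_
  obtain ⟨g, h, h0, e⟩ := exists_mul_polyFun_eq f
  rw [eq_div_of_mul_eq h0 e, polyFun_eq_aevalAeval, polyFun_eq_aevalAeval]
  have hX : W.coordX ∈ adjoin K {W.coordX, W.coordY} := subset_adjoin _ _ (by simp)
  have hY : W.coordY ∈ adjoin K {W.coordX, W.coordY} := subset_adjoin _ _ (by simp)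
  exact div_mem (aevalAeval_mem_of_mem hX hY _) (aevalAeval_mem_of_mem hX hY _)

lemma fieldRange_eq_adjoin (F : W₂.FunctionField →ₐ[K] W₁.FunctionField) :
    F.fieldRange = adjoin K {F W₂.coordX, F W₂.coordY} := by
  rw [AlgHom.fieldRange_eq_map, ← adjoin_coord, adjoin_map, Set.image_pair]

lemma transcendental_coordX (W : Affine K) : Transcendental K W.coordX := by
  rw [transcendental_iff]
  intro n hn
  have h₁ : polyFun W (C n) = polyFun W 0 := by
    rw [polyFun_eq_aevalAeval, aevalAeval_C, hn, map_zero]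
  refine FaithfulSMul.algebraMap_injective K[X] W.CoordinateRing ?_
  rw [map_zero, ← map_zero (CoordinateRing.mk W)]
  exact polyFun_eq_iff.1 h₁

lemma transcendental_map_coordX (F : W₂.FunctionField →ₐ[K] W₁.FunctionField) :
    Transcendental K (F W₂.coordX) :=
  fun h ↦ transcendental_coordX W₂ ((isAlgebraic_algHom_iff F F.injective).1 h)

lemma algHom_ext_coord {F G : W₂.FunctionField →ₐ[K] W₁.FunctionField}
    (hX : F W₂.coordX = G W₂.coordX) (hY : F W₂.coordY = G W₂.coordY) : F = G := by
  have : (⊤ : IntermediateField K W₂.FunctionField) ≤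
      (AlgHom.equalizer F G).toIntermediateField fun f hf ↦ by
        rw [AlgHom.mem_equalizer] at hf ⊢
        rw [map_inv₀, map_inv₀, hf] := by
    rw [← adjoin_coord, adjoin_le_iff]
    rintro f (rfl | rfl)
    exacts [hX, hY]
  exact AlgHom.ext fun f ↦ this mem_top

lemma map_polyFun (F : W₂.FunctionField →ₐ[K] W₁.FunctionField) (g : K[X][Y]) :
    F (polyFun W₂ g) = g.aevalAeval (F W₂.coordX) (F W₂.coordY) := by
  rw [polyFun_eq_aevalAeval]
  have : F.comp (aevalAeval (R := K) W₂.coordX W₂.coordY) =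
      aevalAeval (F W₂.coordX) (F W₂.coordY) := by
    apply (aevalAevalEquiv K _).symm.injective
    simp [aevalAevalEquiv]
  exact DFunLike.congr_fun this g

lemma HasValueAt.map {F : W₂.FunctionField →ₐ[K] W₁.FunctionField} {f : W₂.FunctionField}
    {x y x' y' c : K} (hX : HasValueAt (F W₂.coordX) x y x') (hY : HasValueAt (F W₂.coordY) x y y')
    (h : HasValueAt f x' y' c) : HasValueAt (F f) x y c := by
  obtain ⟨g, h, h0, e, v⟩ := hasValueAt_iff.1 h
  refine (hX.aevalAeval hY h).of_mul_eq (hX.aevalAeval hY g) h0 ?_ v.symm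
  rw [← map_polyFun, ← map_polyFun, ← map_mul, e]

/-- The set of affine points of `W` with coordinates in a finite set is finite. -/
lemma finite_points {S : Set (K × K)} (hS : S.Finite) :
    {P : W.Point | ∃ x y h, P = .some x y h ∧ (x, y) ∈ S}.Finite := by
  refine Set.Finite.of_injOn (f := fun P : W.Point ↦ match P with
    | .zero => (0, 0)
    | .some x y _ => (x, y)) (t := S) ?_ ?_ hS
  · rintro _ ⟨x, y, h, rfl, hxy⟩
    exact hxy
  · rintro _ ⟨x, y, h, rfl, hxy⟩ _ ⟨x', y', h', rfl, hxy'⟩ he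
    obtain ⟨rfl, rfl⟩ := Prod.mk.inj he
    rfl

lemma infinite_point [IsAlgClosed K] (W : Affine K) [W.IsElliptic] : Infinite W.Point := by
  have h : ∀ x : K, ∃ y, W.Equation x y := by
    intro x
    have h0 : (W.polynomial.map (evalRingHom x)).degree ≠ 0 := by
      rw [W.monic_polynomial.degree_map, degree_polynomial]
      decide
    obtain ⟨y, hy⟩ := IsAlgClosed.exists_root _ h0
    refine ⟨y, ?_⟩
    rwa [IsRoot, map_evalRingHom_eval] at hy
  choose y hy using h
  have : Infinite K := inferInstance
  exact Infinite.of_injective (fun x ↦ Point.some x (y x) (equation_iff_nonsingular.1 (hy x)))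
    fun a b hab ↦ (Point.some.inj hab).1

lemma finite_fiber_x (F : W₂.FunctionField →ₐ[K] W₁.FunctionField) (c : K) :
    {P : W₁.Point | ∃ x y h, P = .some x y h ∧ HasValueAt (F W₂.coordX) x y c}.Finite := by
  have h0 : F W₂.coordX - algebraMap K _ c ≠ 0 := fun h ↦
    transcendental_map_coordX F (by rw [sub_eq_zero.1 h]; exact isAlgebraic_algebraMap c)
  refine (finite_points (finite_zeros h0)).subset ?_
  rintro _ ⟨x, y, h, rfl, hv⟩
  refine ⟨x, y, h, rfl, h.1, ?_⟩
  have := hv.sub (hasValueAt_algebraMap c)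
  rwa [sub_self] at this

lemma eq_of_eventually_hasValueAt [Infinite W₁.Point] {f g : W₁.FunctionField}
    (h : ∀ᶠ P : W₁.Point in Filter.cofinite, ∃ x y c, ∃ h : W₁.Nonsingular x y,
      P = .some x y h ∧ HasValueAt f x y c ∧ HasValueAt g x y c) : f = g := by
  by_contra hfg
  have hfin := finite_points (W := W₁) (finite_zeros (sub_ne_zero.2 hfg))
  obtain ⟨P, ⟨x, y, c, hP, rfl, hf, hg⟩, h'⟩ :=
    (h.and hfin.compl_mem_cofinite).exists
  refine h' ⟨x, y, hP, rfl, hP.1, ?_⟩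
  have := hf.sub hg
  rwa [sub_self] at this

lemma finrank_fieldRange_comp (F : W₂.FunctionField →ₐ[K] W₁.FunctionField)
    (G : W₃.FunctionField →ₐ[K] W₂.FunctionField) :
    Module.finrank (F.comp G).fieldRange W₁.FunctionField =
      Module.finrank G.fieldRange W₂.FunctionField *
        Module.finrank F.fieldRange W₁.FunctionField := by
  have h₁ : (F.comp G).fieldRange = G.fieldRange.map F := by
    rw [AlgHom.fieldRange_eq_map, AlgHom.fieldRange_eq_map, IntermediateField.map_map]
  have hle : G.fieldRange.map F ≤ (⊤ : IntermediateField K W₂.FunctionField).map F :=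
    IntermediateField.map_mono F le_top
  rw [h₁, ← relfinrank_mul_finrank_top hle, relfinrank_map_map, relfinrank_top_right,
    ← AlgHom.fieldRange_eq_map]

lemma finrank_fieldRange_of_surjective {F : W₂.FunctionField →ₐ[K] W₁.FunctionField}
    (hF : Function.Surjective F) :
    Module.finrank F.fieldRange W₁.FunctionField = 1 := by
  rw [AlgHom.fieldRange_eq_top.2 hF, IntermediateField.finrank_top]

variable [DecidableEq K] {φ : W₁.Point →+ W₂.Point} {ψ : W₂.Point →+ W₃.Point}
  {F F' : W₂.FunctionField →ₐ[K] W₁.FunctionField} {G : W₃.FunctionField →ₐ[K] W₂.FunctionField}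

lemma IsPullback.finite_fiber (hφ : IsPullback φ F) (S : W₂.Point) : (φ ⁻¹' {S}).Finite := by
  have hfin := Filter.eventually_cofinite.1 hφ
  cases S with
  | zero =>
    refine hfin.subset fun P hP ↦ ?_
    rintro ⟨x, y, x', y', h, h', -, h₂, -⟩
    exact Point.some_ne_zero h' (h₂.symm.trans hP)
  | some a b hab =>
    refine (hfin.union (finite_fiber_x F a)).subset fun P hP ↦ ?_
    rw [Set.mem_union, or_iff_not_imp_left]
    intro hP'
    obtain ⟨x, y, x', y', h, h', h₁, h₂, hX, -⟩ := not_not.1 hP'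
    obtain ⟨rfl, rfl⟩ := Point.some.inj (h₂.symm.trans hP)
    exact ⟨x, y, h, h₁, hX⟩

lemma IsPullback.comp (hφ : IsPullback φ F) (hψ : IsPullback ψ G) :
    IsPullback (ψ.comp φ) (F.comp G) := by
  have ht : Filter.Tendsto φ Filter.cofinite Filter.cofinite :=
    Filter.Tendsto.cofinite_of_finite_preimage_singleton hφ.finite_fiber
  filter_upwards [hφ, ht.eventually hψ] with P hP hP'
  obtain ⟨x, y, x', y', h, h', h₁, h₂, hX, hY⟩ := hP
  obtain ⟨x₂, y₂, x'', y'', k, k', k₁, k₂, kX, kY⟩ := hP'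
  obtain ⟨rfl, rfl⟩ := Point.some.inj (h₂.symm.trans k₁)
  refine ⟨x, y, x'', y'', h, k', h₁, k₂, ?_, ?_⟩
  · rw [AlgHom.comp_apply]
    exact hX.map hY kX
  · rw [AlgHom.comp_apply]
    exact hX.map hY kY

lemma isPullback_id (W : Affine K) : IsPullback (AddMonoidHom.id W.Point) (AlgHom.id K _) := by
  refine Filter.mem_of_superset (Set.finite_singleton (0 : W.Point)).compl_mem_cofinite ?_
  intro P hP
  cases P with
  | zero => exact absurd rfl hP
  | some x y h => exact ⟨x, y, x, y, h, h, rfl, rfl, hasValueAt_coordX, hasValueAt_coordY⟩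

/-- The pullback is determined by the action on points. -/
lemma IsPullback.unique [Infinite W₁.Point] (h : IsPullback φ F) (h' : IsPullback φ F') :
    F = F' := by
  have key := h.and h'
  refine algHom_ext_coord (eq_of_eventually_hasValueAt ?_) (eq_of_eventually_hasValueAt ?_) <;>
  · filter_upwards [key] with P ⟨⟨x, y, x', y', k, k', k₁, k₂, kX, kY⟩,
      ⟨u, v, u', v', l, l', l₁, l₂, lX, lY⟩⟩
    obtain ⟨rfl, rfl⟩ := Point.some.inj (k₁.symm.trans l₁)
    obtain ⟨rfl, rfl⟩ := Point.some.inj (k₂.symm.trans l₂)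
    exact ⟨x, y, _, k, k₁, by assumption, by assumption⟩

lemma isIsogenyOfDegree_iff {d : ℕ} (hd : 0 < d) : IsIsogenyOfDegree φ d ↔
    ∃ F : W₂.FunctionField →ₐ[K] W₁.FunctionField, IsPullback φ F ∧
      Module.finrank F.fieldRange W₁.FunctionField = d :=
  exists_congr fun F ↦ and_congr_right fun _ ↦
    ⟨fun h ↦ h.2, fun h ↦ ⟨Module.finite_of_finrank_pos (by rwa [h]), h⟩⟩

lemma IsIsogenyOfDegree.pos {d : ℕ} (h : IsIsogenyOfDegree φ d) : 0 < d := by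
  obtain ⟨F, -, _, rfl⟩ := h
  exact Module.finrank_pos

lemma IsIsogenyOfDegree.comp {d e : ℕ} (hφ : IsIsogenyOfDegree φ d) (hψ : IsIsogenyOfDegree ψ e) :
    IsIsogenyOfDegree (ψ.comp φ) (d * e) := by
  rw [isIsogenyOfDegree_iff (Nat.mul_pos hφ.pos hψ.pos)]
  obtain ⟨F, hF, -, rfl⟩ := hφ
  obtain ⟨G, hG, -, rfl⟩ := hψ
  exact ⟨F.comp G, hF.comp hG, by rw [finrank_fieldRange_comp, mul_comm]⟩

lemma isIsogenyOfDegree_id (W : Affine K) : IsIsogenyOfDegree (AddMonoidHom.id W.Point) 1 :=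
  (isIsogenyOfDegree_iff one_pos).2
    ⟨_, isPullback_id W, finrank_fieldRange_of_surjective Function.surjective_id⟩

lemma isIsomorphism_refl (W : Affine K) : IsIsomorphism (AddEquiv.refl W.Point) :=
  ⟨⟨_, isPullback_id W⟩, ⟨_, isPullback_id W⟩⟩

lemma IsIsomorphism.isIsogenyOfDegree_one [Infinite W₁.Point] {e : W₁.Point ≃+ W₂.Point}
    (he : IsIsomorphism e) : IsIsogenyOfDegree e.toAddMonoidHom 1 := by
  obtain ⟨⟨F, hF⟩, ⟨G, hG⟩⟩ := he
  refine (isIsogenyOfDegree_iff one_pos).2 ⟨F, hF, finrank_fieldRange_of_surjective fun f ↦ ?_⟩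
  have hid : e.symm.toAddMonoidHom.comp e.toAddMonoidHom = AddMonoidHom.id _ :=
    AddMonoidHom.ext fun P ↦ e.symm_apply_apply P
  have hc := hF.comp hG
  rw [hid] at hc
  exact ⟨G f, DFunLike.congr_fun (hc.unique (isPullback_id W₁)) f⟩

end WeierstrassCurve.Affine

/-! ### Points over function fields -/

namespace WeierstrassCurve.Affine

open Polynomial IntermediateField

section CoordField

variable {K L : Type*} [Field K] [Field L] [Algebra K L] {W : Affine K}

/-- The constant point of `W` over `L` given by a point over `K`. -/
noncomputable def constPoint (L : Type*) [Field L] [Algebra K L] : W.Point → (W⁄L).Point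
  | .zero => 0
  | .some x y h => .some (algebraMap K L x) (algebraMap K L y)
      ((W.map_nonsingular (algebraMap K L).injective x y).2 h)

/-- The field generated by the coordinates of a point. -/
noncomputable def coordField : (W⁄L).Point → IntermediateField K L
  | .zero => ⊥
  | .some x y _ => adjoin K {x, y}

lemma equation_baseChange_iff {x y : L} :
    (W⁄L).Equation x y ↔ W.polynomial.aevalAeval x y = 0 := by
  rw [equation_iff', polynomial]
  simp only [map_sub, map_add, map_mul, map_pow, aevalAeval_C, aevalAeval_Y, aeval_C, aeval_X]
  rw [add_mul, ← add_assoc]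
  rfl

instance [W.IsElliptic] : (W⁄L).IsElliptic :=
  inferInstanceAs (W.map (algebraMap K L)).IsElliptic

/-- The `x`-coordinate generates a subfield of index at most two in the field of coordinates. -/
lemma finrank_adjoin_x_le {x y : L} (h : (W⁄L).Nonsingular x y)
    [FiniteDimensional (coordField (.some x y h)) L] :
    FiniteDimensional K⟮x⟯ L ∧
      Module.finrank K⟮x⟯ L ≤ 2 * Module.finrank (coordField (.some x y h)) L := by
  set q := W.polynomial.map (polynomialToAdjoin x : K[X] →ₐ[K] K⟮x⟯).toRingHom with hq
  have hmonic : q.Monic := W.monic_polynomial.map _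
  have h0 : aeval y q = 0 := by
    rw [hq, aeval_map_polynomialToAdjoin]
    exact equation_baseChange_iff.1 h.1
  have hint : _root_.IsIntegral K⟮x⟯ y := ⟨q, hmonic, h0⟩
  have hdeg : (minpoly K⟮x⟯ y).natDegree ≤ 2 := by
    refine (natDegree_le_natDegree (minpoly.min _ _ hmonic h0)).trans ?_
    rw [hq, W.monic_polynomial.natDegree_map, natDegree_polynomial]
  have e := finrank_adjoin_simple_eq hint
  have hpos : 0 < Module.finrank (adjoin K {x, y}) L :=
    Module.finrank_pos (R := coordField (.some x y h)) (M := L)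
  refine ⟨FiniteDimensional.of_finrank_pos ?_, ?_⟩
  · rw [e]
    exact Nat.mul_pos (minpoly.natDegree_pos hint) hpos
  · rw [e]
    exact Nat.mul_le_mul_right _ hdeg

lemma coordField_constPoint (Q : W.Point) : coordField (constPoint L Q) = ⊥ := by
  cases Q with
  | zero => rfl
  | some x y h =>
    change adjoin K {algebraMap K L x, algebraMap K L y} = ⊥
    rw [eq_bot_iff, adjoin_le_iff, Set.insert_subset_iff, Set.singleton_subset_iff]
    exact ⟨IntermediateField.algebraMap_mem _ _, IntermediateField.algebraMap_mem _ _⟩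

variable [DecidableEq L]

lemma coordField_le_iff {M : IntermediateField K L} [DecidableEq M]
    {ξ : (W⁄L).Point} :
    coordField ξ ≤ M ↔ ξ ∈ (Point.map (W' := W) M.val).range := by
  constructor
  · intro h
    cases ξ with
    | zero => exact zero_mem _
    | some x y hxy =>
      rw [coordField, adjoin_le_iff, Set.insert_subset_iff, Set.singleton_subset_iff] at h
      exact ⟨.some ⟨x, h.1⟩ ⟨y, h.2⟩
        ((W.baseChange_nonsingular M.val.injective ⟨x, h.1⟩ ⟨y, h.2⟩).1 hxy), rfl⟩
  · rintro ⟨P, rfl⟩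
    cases P with
    | zero => exact bot_le
    | some x y hxy =>
      change adjoin K {(x : L), (y : L)} ≤ M
      rw [adjoin_le_iff, Set.insert_subset_iff, Set.singleton_subset_iff]
      exact ⟨x.2, y.2⟩

lemma coordField_neg (ξ : (W⁄L).Point) : coordField (-ξ) = coordField ξ := by
  classical
  have key : ∀ ξ : (W⁄L).Point, coordField (-ξ) ≤ coordField ξ := fun ξ ↦
    coordField_le_iff.2 (neg_mem (coordField_le_iff.1 le_rfl))
  exact (key ξ).antisymm (by simpa using key (-ξ))

lemma coordField_add_constPoint (ξ : (W⁄L).Point) (Q : W.Point) :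
    coordField (ξ + constPoint L Q) = coordField ξ := by
  classical
  have hQ : ∀ M : IntermediateField K L, constPoint L Q ∈ (Point.map (W' := W) M.val).range :=
    fun M ↦ coordField_le_iff.1 (by rw [coordField_constPoint]; exact bot_le)
  apply le_antisymm
  · exact coordField_le_iff.2 (add_mem (coordField_le_iff.1 le_rfl) (hQ _))
  · have := sub_mem (coordField_le_iff.1 (le_refl (coordField (ξ + constPoint L Q)))) (hQ _)
    rw [add_sub_cancel_right] at this
    exact coordField_le_iff.2 this

end CoordField

section Specialization

variable {K : Type*} [Field K] {W₁ W₂ : Affine K}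

/-- The point of `W₂` over the function field of `W₁` given by an embedding of function fields. -/
noncomputable def genericPoint [W₂.IsElliptic] (F : W₂.FunctionField →ₐ[K] W₁.FunctionField) :
    (W₂⁄W₁.FunctionField).Point :=
  .some (F W₂.coordX) (F W₂.coordY) <| equation_iff_nonsingular.1 <| by
    rw [equation_baseChange_iff, ← map_polyFun]
    have : polyFun W₂ W₂.polynomial = polyFun W₂ 0 :=
      polyFun_eq_iff.2 (by rw [map_zero]; exact AdjoinRoot.mk_self)
    rw [this, map_zero, map_zero]

lemma coordField_genericPoint [W₂.IsElliptic] (F : W₂.FunctionField →ₐ[K] W₁.FunctionField) :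
    coordField (genericPoint F) = F.fieldRange :=
  (fieldRange_eq_adjoin F).symm

/-- The point `ξ` of `W₂` over the function field of `W₁`, that is a rational map from `W₁` to `W₂`,
is defined at `T` and takes the value `S` there, both points being affine. -/
def Specializes (ξ : (W₂⁄W₁.FunctionField).Point) (T : W₁.Point) (S : W₂.Point) : Prop :=
  ∃ (x y : K) (h : W₁.Nonsingular x y) (U V : W₁.FunctionField)
    (hUV : (W₂⁄W₁.FunctionField).Nonsingular U V) (u v : K) (huv : W₂.Nonsingular u v),
    T = .some x y h ∧ ξ = .some U V hUV ∧ S = .some u v huv ∧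
      HasValueAt U x y u ∧ HasValueAt V x y v

variable {ξ : (W₂⁄W₁.FunctionField).Point} {T : W₁.Point} {S S' : W₂.Point}

lemma Specializes.unique (h : Specializes ξ T S) (h' : Specializes ξ T S') : S = S' := by
  obtain ⟨x, y, hxy, U, V, hUV, u, v, huv, rfl, rfl, rfl, hU, hV⟩ := h
  obtain ⟨x', y', hxy', U', V', hUV', u', v', huv', e₁, e₂, rfl, hU', hV'⟩ := h'
  obtain ⟨rfl, rfl⟩ := Point.some.inj e₁
  obtain ⟨rfl, rfl⟩ := Point.some.inj e₂
  obtain rfl := hU.unique hxy.1 hU'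
  obtain rfl := hV.unique hxy.1 hV'
  rfl

lemma HasValueAt.negY {U V : W₁.FunctionField} {x y u v : K} (hU : HasValueAt U x y u)
    (hV : HasValueAt V x y v) :
    HasValueAt ((W₂⁄W₁.FunctionField).negY U V) x y (W₂.negY u v) :=
  (hV.neg.sub ((hasValueAt_algebraMap _).mul hU)).sub (hasValueAt_algebraMap _)

lemma Specializes.neg (h : Specializes ξ T S) : Specializes (-ξ) T (-S) := by
  obtain ⟨x, y, hxy, U, V, hUV, u, v, huv, rfl, rfl, rfl, hU, hV⟩ := h
  exact ⟨x, y, hxy, U, _, _, u, _, _, rfl, Point.neg_some hUV, Point.neg_some huv, hU, hU.negY hV⟩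

/-- Regularity of the slope of the line through a moving point and a constant one. -/
lemma hasValueAt_slope [DecidableEq K] [DecidableEq W₁.FunctionField] {U V : W₁.FunctionField}
    {x y u v a b : K} (hxy : W₁.Equation x y) (hUV : (W₂⁄W₁.FunctionField).Equation U V)
    (huv : W₂.Equation u v) (hab : W₂.Equation a b) (hU : HasValueAt U x y u)
    (hV : HasValueAt V x y v) (hne : ¬(u = a ∧ v = W₂.negY a b)) (hUa : U ≠ algebraMap K _ a) :
    HasValueAt ((W₂⁄W₁.FunctionField).slope U (algebraMap K _ a) V (algebraMap K _ b)) x y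
      (W₂.slope u a v b) := by
  have hc := fun c : K ↦ hasValueAt_algebraMap (W := W₁) (x := x) (y := y) c
  rw [slope_of_X_ne hUa]
  by_cases hua : u = a
  · subst hua
    have hvb : v ≠ W₂.negY u b := fun h ↦ hne ⟨rfl, h⟩
    obtain rfl : v = b := Y_eq_of_Y_ne huv hab rfl hvb
    rw [slope_of_Y_ne rfl hvb]
    have hden := hV.sub (hU.negY (W₂ := W₂) (hc v))
    have hnum := (((((hU.pow 2).add (hU.mul (hc u))).add ((hc u).pow 2)).add
      ((hc W₂.a₂).mul (hU.add (hc u)))).add (hc W₂.a₄)).sub ((hc W₂.a₁).mul (hc v))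
    refine hden.of_mul_eq hnum (sub_ne_zero.2 hvb) ?_ ?_
    · rw [div_mul_eq_mul_div, div_eq_iff (sub_ne_zero.2 hUa)]
      have e₁ := ((W₂⁄W₁.FunctionField).equation_iff' U V).1 hUV
      have e₂ := ((W₂⁄W₁.FunctionField).equation_iff' _ _).1
        (Equation.map (algebraMap K W₁.FunctionField) huv)
      change _ + algebraMap K _ W₂.a₁ * _ * _ + algebraMap K _ W₂.a₃ * _ - (_ + algebraMap K _ W₂.a₂
        * _ + algebraMap K _ W₂.a₄ * _ + algebraMap K _ W₂.a₆) = 0 at e₁ e₂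
      change _ * (V - (-algebraMap K _ v - algebraMap K _ W₂.a₁ * U - algebraMap K _ W₂.a₃)) = _
      linear_combination e₁ - e₂
    · rw [div_mul_cancel₀ _ (sub_ne_zero.2 hvb)]
      ring
  · rw [slope_of_X_ne hua]
    exact (hV.sub (hc b)).div (hU.sub (hc a)) hxy (sub_ne_zero.2 hua)

lemma Specializes.add_constPoint [DecidableEq K] [DecidableEq W₁.FunctionField]
    (h : Specializes ξ T S) (hξ : coordField ξ ≠ ⊥) {Q : W₂.Point} (hQ : S + Q ≠ 0) :
    Specializes (ξ + constPoint _ Q) T (S + Q) := by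
  cases Q with
  | zero =>
    change Specializes (ξ + 0) T (S + 0)
    rwa [add_zero, add_zero]
  | some a b hab =>
    obtain ⟨x, y, hxy, U, V, hUV, u, v, huv, rfl, rfl, rfl, hU, hV⟩ := h
    have hne : ¬(u = a ∧ v = W₂.negY a b) := fun h ↦ hQ (Point.add_of_Y_eq h.1 h.2)
    have hUa : U ≠ algebraMap K _ a := by
      intro hUa
      refine hξ (eq_bot_iff.2 ?_)
      change adjoin K {U, V} ≤ ⊥
      rw [adjoin_le_iff, Set.insert_subset_iff, Set.singleton_subset_iff]
      refine ⟨hUa ▸ IntermediateField.algebraMap_mem _ a, ?_⟩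
      rcases Y_eq_of_X_eq hUV.1 (Equation.map (algebraMap K _) hab.1) hUa with h | h
      · exact h ▸ IntermediateField.algebraMap_mem _ b
      · have := W₂.map_negY (algebraMap K W₁.FunctionField) a b
        exact (h.trans this) ▸ IntermediateField.algebraMap_mem _ _
    have hs := hasValueAt_slope hxy.1 hUV.1 huv.1 hab.1 hU hV hne hUa
    have hc := fun c : K ↦ hasValueAt_algebraMap (W := W₁) (x := x) (y := y) c
    have hX : HasValueAt ((W₂⁄W₁.FunctionField).addX U (algebraMap K _ a)
        ((W₂⁄W₁.FunctionField).slope U (algebraMap K _ a) V (algebraMap K _ b))) x y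
        (W₂.addX u a (W₂.slope u a v b)) :=
      ((((hs.pow 2).add ((hc _).mul hs)).sub (hc _)).sub hU).sub (hc _)
    exact ⟨x, y, hxy, _, _, _, _, _, _, rfl, Point.add_of_X_ne hUa, Point.add_some hne, hX,
      hX.negY ((hs.mul (hX.sub hU)).add hV)⟩

end Specialization

end WeierstrassCurve.Affine

/-! ### Coincidences of isogenies -/

/-- A homomorphism from an infinite group which is constant almost everywhere is trivial. -/
lemma AddMonoidHom.eq_zero_of_eventually_eq {A B : Type*} [AddCommGroup A] [AddCommGroup B]
    [Infinite A] (γ : A →+ B) {b : B} (h : ∀ᶠ T in Filter.cofinite, γ T = b) : γ = 0 := by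
  refine AddMonoidHom.ext fun t ↦ ?_
  have ht := (add_left_injective t).tendsto_cofinite.eventually h
  obtain ⟨T, h₁, h₂⟩ := (h.and ht).exists
  rw [map_add, h₁] at h₂
  simpa using h₂

lemma Transcendental.of_notMem_range {K L : Type*} [Field K] [IsAlgClosed K] [Field L] [Algebra K L]
    {f : L} (h : f ∉ (algebraMap K L).range) : Transcendental K f := fun hf ↦
  h (minpoly.mem_range_of_degree_eq_one K f
    (IsAlgClosed.degree_eq_one_of_irreducible K (minpoly.irreducible hf.isIntegral)))

namespace WeierstrassCurve.Affine

open Polynomial IntermediateField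

variable {K : Type*} [Field K] {W₁ W₂ : Affine K}

/-- A nonconstant difference `U₁ - U₂` vanishes in at most `deg U₁ + deg U₂` points. -/
lemma card_le_of_hasValueAt [IsAlgClosed K] {U₁ U₂ : W₁.FunctionField} (hne : U₁ ≠ U₂)
    [FiniteDimensional K⟮U₁⟯ W₁.FunctionField] [FiniteDimensional K⟮U₂⟯ W₁.FunctionField]
    (s : Finset W₁.Point) (hs : ∀ T ∈ s, ∃ x y c, ∃ h : W₁.Nonsingular x y,
      T = .some x y h ∧ HasValueAt U₁ x y c ∧ HasValueAt U₂ x y c) :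
    s.card ≤ Module.finrank K⟮U₁⟯ W₁.FunctionField + Module.finrank K⟮U₂⟯ W₁.FunctionField := by
  classical
  have hs' : ∀ T ∈ s, ∃ x y, ∃ h : W₁.Nonsingular x y,
      T = .some x y h ∧ HasValueAt (U₁ - U₂) x y 0 := fun T hT ↦ by
    obtain ⟨x, y, c, h, rfl, h₁, h₂⟩ := hs T hT
    exact ⟨x, y, h, rfl, by simpa using h₁.sub h₂⟩
  rcases s.eq_empty_or_nonempty with rfl | ⟨T₀, hT₀⟩
  · simp
  have htr : Transcendental K (U₁ - U₂) := by
    refine Transcendental.of_notMem_range ?_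
    rintro ⟨c, hc⟩
    obtain ⟨x, y, h, -, hv⟩ := hs' T₀ hT₀
    have h0 := (hasValueAt_algebraMap (W := W₁) (x := x) (y := y) c).unique h.1 (hc ▸ hv)
    rw [h0, map_zero] at hc
    exact hne (sub_eq_zero.1 hc.symm)
  obtain ⟨_, hle⟩ := finrank_adjoin_sub_le U₁ U₂ htr
  refine le_trans ?_ hle
  let coords : W₁.Point → K × K := fun P ↦ match P with
    | .zero => (0, 0)
    | .some x y _ => (x, y)
  have hinj : Set.InjOn coords s := by
    intro T hT T' hT' he
    obtain ⟨x, y, h, rfl, -⟩ := hs' T hT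
    obtain ⟨x', y', h', rfl, -⟩ := hs' T' hT'
    obtain ⟨rfl, rfl⟩ := Prod.mk.inj he
    rfl
  rw [← Finset.card_image_of_injOn hinj]
  refine card_le_finrank_adjoin htr 0 _ fun t ht ↦ ?_
  obtain ⟨T, hT, rfl⟩ := Finset.mem_image.1 ht
  obtain ⟨x, y, h, rfl, hv⟩ := hs' T hT
  exact ⟨h.1, hv⟩

lemma coordField_genericPoint_ne_bot [W₂.IsElliptic]
    (F : W₂.FunctionField →ₐ[K] W₁.FunctionField) : coordField (genericPoint F) ≠ ⊥ := by
  intro h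
  have hmem : F W₂.coordX ∈ (⊥ : IntermediateField K W₁.FunctionField) := by
    rw [← h, coordField_genericPoint]
    exact ⟨_, rfl⟩
  obtain ⟨c, hc⟩ := IntermediateField.mem_bot.1 hmem
  exact transcendental_map_coordX F (hc ▸ isAlgebraic_algebraMap c)

variable [DecidableEq K]

lemma IsPullback.eventually_specializes [W₂.IsElliptic] {φ : W₁.Point →+ W₂.Point}
    {F : W₂.FunctionField →ₐ[K] W₁.FunctionField} (h : IsPullback φ F) :
    ∀ᶠ T in Filter.cofinite, Specializes (genericPoint F) T (φ T) := by
  filter_upwards [h] with T ⟨x, y, x', y', hxy, hxy', h₁, h₂, hX, hY⟩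
  exact ⟨x, y, hxy, _, _, _, x', y', hxy', h₁, rfl, h₂, hX, hY⟩

/-- Two isogenies of degrees `m` and `n` that agree at a point of order `N > 2 * (m + n)` are equal
up to sign. -/
theorem eq_or_eq_neg_of_apply_eq [IsAlgClosed K] [W₁.IsElliptic] [W₂.IsElliptic]
    {α β : W₁.Point →+ W₂.Point} {m n : ℕ} (hα : IsIsogenyOfDegree α m)
    (hβ : IsIsogenyOfDegree β n) {P : W₁.Point} (hP : α P = β P)
    (hN : 2 * (m + n) < addOrderOf P) : m = n ∧ (α = β ∨ α = -β) := by
  classical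
  have := infinite_point W₁
  obtain ⟨F, hF, hFfin, rfl⟩ := hα
  obtain ⟨G, hG, hGfin, rfl⟩ := hβ
  have hgood : ∀ᶠ T in Filter.cofinite, ∀ j ∈ Finset.range (addOrderOf P),
      Specializes (genericPoint F) (T + j • P) (α (T + j • P)) ∧
        Specializes (genericPoint G) (T + j • P) (β (T + j • P)) := by
    rw [Filter.eventually_all_finset]
    exact fun j _ ↦ (add_left_injective (j • P)).tendsto_cofinite.eventually
      (hF.eventually_specializes.and hG.eventually_specializes)
  obtain ⟨T₀, hT₀⟩ := hgood.exists
  set Q := α T₀ - β T₀ with hQ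
  have htrans : ∀ T, Specializes (genericPoint G) T (β T) → β T + Q ≠ 0 →
      Specializes (genericPoint G + constPoint _ Q) T (β T + Q) := fun T h h0 ↦
    h.add_constPoint (coordField_genericPoint_ne_bot G) h0
  have hfield : coordField (genericPoint G + constPoint _ Q) = G.fieldRange := by
    rw [coordField_add_constPoint, coordField_genericPoint]
  have hj : ∀ j ∈ Finset.range (addOrderOf P), Specializes (genericPoint F) (T₀ + j • P)
      (α (T₀ + j • P)) ∧
      Specializes (genericPoint G + constPoint _ Q) (T₀ + j • P) (α (T₀ + j • P)) := by
    intro j hj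
    obtain ⟨h₁, h₂⟩ := hT₀ j hj
    refine ⟨h₁, ?_⟩
    have he : β (T₀ + j • P) + Q = α (T₀ + j • P) := by
      rw [hQ, map_add, map_add, map_nsmul, map_nsmul, hP]
      abel
    rw [← he]
    refine htrans _ h₂ ?_
    rw [he]
    obtain ⟨_, _, _, _, _, _, _, _, h, _, _, e, _⟩ := h₁
    rw [e]
    exact Point.some_ne_zero h
  have hNpos : 0 < addOrderOf P := by omega
  obtain ⟨U₁, V₁, k₁, e₁⟩ : ∃ U V h, genericPoint F = .some U V h := ⟨_, _, _, rfl⟩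
  obtain ⟨U₂, V₂, k₂, e₂⟩ : ∃ U V h, genericPoint G + constPoint _ Q = .some U V h := by
    obtain ⟨_, _, _, U, V, h, _, _, _, _, e, _⟩ := (hj 0 (by simpa using hNpos)).2
    exact ⟨U, V, h, e⟩
  have c₁ : coordField (.some U₁ V₁ k₁) = F.fieldRange := by rw [← e₁, coordField_genericPoint]
  have c₂ : coordField (.some U₂ V₂ k₂) = G.fieldRange := by rw [← e₂, hfield]
  by_cases hU : U₁ = U₂
  · have hev : ∀ᶠ T in Filter.cofinite, Specializes (genericPoint F) T (α T) ∧
        Specializes (genericPoint G + constPoint _ Q) T (β T + Q) := by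
      filter_upwards [hF.eventually_specializes, hG.eventually_specializes,
        (hG.finite_fiber (-Q)).compl_mem_cofinite] with T h₁ h₂ h₃
      exact ⟨h₁, htrans T h₂ fun h ↦ h₃ (eq_neg_of_add_eq_zero_left h)⟩
    rcases Point.X_eq_iff (h₁ := k₁) (h₂ := k₂) |>.1 hU with h | h
    · refine ⟨by rw [← c₁, ← c₂, h], Or.inl (sub_eq_zero.1 ?_)⟩
      refine AddMonoidHom.eq_zero_of_eventually_eq (α - β) (b := Q) ?_
      filter_upwards [hev] with T ⟨h₁, h₂⟩
      rw [e₁, h, ← e₂] at h₁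
      rw [AddMonoidHom.sub_apply, h₁.unique h₂, add_sub_cancel_left]
    · refine ⟨by rw [← c₁, ← c₂, h, coordField_neg], Or.inr (eq_neg_of_add_eq_zero_left ?_)⟩
      refine AddMonoidHom.eq_zero_of_eventually_eq (α + β) (b := -Q) ?_
      filter_upwards [hev] with T ⟨h₁, h₂⟩
      rw [e₁, h, ← e₂] at h₁
      rw [AddMonoidHom.add_apply, h₁.unique h₂.neg]
      abel
  · exfalso
    have i₁ : FiniteDimensional (coordField (.some U₁ V₁ k₁)) W₁.FunctionField := by rwa [c₁]
    have i₂ : FiniteDimensional (coordField (.some U₂ V₂ k₂)) W₁.FunctionField := by rwa [c₂]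
    obtain ⟨_, d₁⟩ := finrank_adjoin_x_le k₁
    obtain ⟨_, d₂⟩ := finrank_adjoin_x_le k₂
    rw [c₁] at d₁
    rw [c₂] at d₂
    have hcard := card_le_of_hasValueAt hU
      ((Finset.range (addOrderOf P)).image fun j ↦ T₀ + j • P) (by
        intro T hT
        obtain ⟨j, hj', rfl⟩ := Finset.mem_image.1 hT
        obtain ⟨⟨x, y, h, U, V, hUV, u, v, huv, t₁, t₂, t₃, t₄, t₅⟩,
          ⟨x', y', h', U', V', hUV', u', v', huv', t₁', t₂', t₃', t₄', t₅'⟩⟩ := hj j hj'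
        obtain ⟨rfl, rfl⟩ := Point.some.inj (e₁.symm.trans t₂)
        obtain ⟨rfl, rfl⟩ := Point.some.inj (e₂.symm.trans t₂')
        obtain ⟨rfl, rfl⟩ := Point.some.inj (t₁.symm.trans t₁')
        obtain ⟨rfl, rfl⟩ := Point.some.inj (t₃.symm.trans t₃')
        exact ⟨x, y, u, h, t₁, t₄, t₄'⟩)
    rw [Finset.card_image_of_injOn, Finset.card_range] at hcard
    · omega
    · intro i hi j hj he
      exact nsmul_injOn_Iio_addOrderOf (by simpa using hi) (by simpa using hj)
        (add_left_cancel he)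

end WeierstrassCurve.Affine

/-! ### The supersingular graphs -/

namespace PointedCurve

variable {K : Type*} [Field K] [DecidableEq K] {A B : PointedCurve K}

/-- For `N > 4 * ℓ`, there is at most one isogeny `(E, P) → (E₁, P₁)` of degree `ℓ`. -/
lemma isogenies_subsingleton [IsAlgClosed K] {ℓ N : ℕ} (hN : 4 * ℓ < N)
    (hA : addOrderOf A.point = N) (hB : addOrderOf B.point = N) :
    (isogenies ℓ A B).Subsingleton := by
  intro f hf g hg
  have := A.isElliptic
  have := B.isElliptic
  rcases (eq_or_eq_neg_of_apply_eq hf.1 hg.1 (hf.2.trans hg.2.symm) (by omega)).2 with h | h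
  · exact h
  · exfalso
    have h₁ : B.point = -B.point := by
      conv_lhs => rw [← hf.2, h, AddMonoidHom.neg_apply, hg.2]
    have h₂ : 2 • B.point = 0 := by
      rw [two_nsmul]
      nth_rewrite 2 [h₁]
      exact add_neg_cancel _
    have h₃ := Nat.le_of_dvd two_pos (addOrderOf_dvd_of_nsmul_eq_zero h₂)
    have := hf.1.pos
    omega

lemma orbit_subset_isogenies [IsAlgClosed K] {ℓ : ℕ} {f : A.curve.Point →+ B.curve.Point}
    (hf : f ∈ isogenies ℓ A B) : orbit f ⊆ isogenies ℓ A B := by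
  rintro _ ⟨e, he, rfl⟩
  have := B.isElliptic
  have := infinite_point B.curve
  refine ⟨by simpa using hf.1.comp he.1.isIsogenyOfDegree_one, ?_⟩
  change e (f A.point) = B.point
  rw [hf.2, he.2]

lemma mem_orbit_self (f : A.curve.Point →+ B.curve.Point) : f ∈ orbit f :=
  ⟨AddEquiv.refl _, ⟨isIsomorphism_refl _, rfl⟩, rfl⟩

end PointedCurve

namespace SupersingularGraph

variable {K : Type*} [Field K] [DecidableEq K] {R : Set (PointedCurve K)} {ℓ : ℕ}

/-- Composing labels along a path of length `k` gives an isogeny of degree `ℓ ^ k`. -/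
lemma exists_isogeny_of_path {A B : SupersingularGraph R ℓ} (w : Quiver.Path A B) :
    (PointedCurve.isogenies (ℓ ^ w.length) A.val B.val).Nonempty := by
  induction w with
  | nil => exact ⟨AddMonoidHom.id _, isIsogenyOfDegree_id _, rfl⟩
  | cons w a ih =>
    obtain ⟨f, hf, hfP⟩ := ih
    obtain ⟨g, ⟨hg, hgP⟩, -⟩ := SupersingularGraph.Arrow.isOrbit a
    refine ⟨g.comp f, ?_, ?_⟩
    · rw [Quiver.Path.length_cons, pow_succ]
      exact hf.comp hg
    · rw [AddMonoidHom.comp_apply, hfP, hgP]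

/-- The level is bounded in terms of the length of a closed walk. -/
lemma level_le_of_closed_path [IsAlgClosed K] (hℓ : 1 < ℓ) {A : SupersingularGraph R ℓ}
    (w : Quiver.Path A A) (hw : 0 < w.length) : addOrderOf A.val.point ≤ 4 * ℓ ^ w.length := by
  by_contra! hN
  have := A.val.isElliptic
  obtain ⟨f, hf, hfP⟩ := exists_isogeny_of_path w
  have hpow : 1 < ℓ ^ w.length := Nat.one_lt_pow hw.ne' hℓ
  have := (eq_or_eq_neg_of_apply_eq hf (isIsogenyOfDegree_id _) (P := A.val.point) hfP
    (by omega)).1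
  omega

end SupersingularGraph

theorem mainTheorem12 {K : Type*} [Field K] [DecidableEq K] (p ℓ N : ℕ) [Fact p.Prime]
    [Algebra (ZMod p) K] [IsAlgClosure (ZMod p) K]
    (hℓ : ℓ.Prime) (hpℓ : p ≠ ℓ) (hN : N.Coprime (p * ℓ))
    (Rep : Set (PointedCurve K)) (hRep : PointedCurve.IsSystemOfRepresentatives p N Rep) :
    (4 * ℓ ^ 2 < N →
      (∀ A : SupersingularGraph Rep ℓ, IsEmpty (A ⟶ A)) ∧
      (∀ A B : SupersingularGraph Rep ℓ, Subsingleton (A ⟶ B)) ∧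
      (∀ (A B : SupersingularGraph Rep ℓ) (a : A ⟶ B),
        ∃! f, f ∈ SupersingularGraph.labels a)) ∧
    ((Real.logb ℓ ((N : ℝ) / 4) : ℝ) : EReal) ≤
      ((Quiver.girth (SupersingularGraph Rep ℓ) : ℝ≥0∞) : EReal) := by
  have : IsAlgClosed K := IsAlgClosure.isAlgClosed (ZMod p)
  have hord : ∀ A : SupersingularGraph Rep ℓ, addOrderOf A.val.point = N := fun A ↦
    (hRep.1 A.val A.mem).2
  have hℓ1 : 1 < ℓ := hℓ.one_lt
  constructor
  · intro hlt
    have hlt' : 4 * ℓ < N := by nlinarith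
    have hsub : ∀ A B : SupersingularGraph Rep ℓ,
        (PointedCurve.isogenies ℓ A.val B.val).Subsingleton := fun A B ↦
      PointedCurve.isogenies_subsingleton hlt' (hord A) (hord B)
    refine ⟨fun A ↦ ⟨fun a ↦ ?_⟩, fun A B ↦ ⟨?_⟩, fun A B a ↦ ?_⟩
    · have := SupersingularGraph.level_le_of_closed_path hℓ1 a.toPath Nat.one_pos
      rw [hord, Quiver.Path.length_toPath, pow_one] at this
      omega
    · rintro ⟨_, f, hf, rfl⟩ ⟨_, g, hg, rfl⟩
      obtain rfl := hsub A B hf hg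
      rfl
    · obtain ⟨_, f, hf, rfl⟩ := a
      exact ⟨f, PointedCurve.mem_orbit_self f, fun g hg ↦
        hsub A B (PointedCurve.orbit_subset_isogenies hf hg) hf⟩
  · set k := ⌈Real.logb ℓ ((N : ℝ) / 4)⌉₊ with hk
    have hgirth : (k : ℕ∞) ≤ Quiver.girth (SupersingularGraph Rep ℓ) := by
      refine le_iInf fun A ↦ le_iInf fun w ↦ le_iInf fun hw ↦ ?_
      rw [Nat.cast_le, hk, Nat.ceil_le]
      have hle := SupersingularGraph.level_le_of_closed_path hℓ1 w hw.1
      rw [hord] at hle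
      have hle' : (N : ℝ) ≤ 4 * (ℓ : ℝ) ^ w.length := by exact_mod_cast hle
      have hℓR : (1 : ℝ) < ℓ := by exact_mod_cast hℓ1
      have hNpos : 0 < N := Nat.pos_of_ne_zero fun h ↦ by
        rw [h, Nat.coprime_zero_left] at hN
        exact hℓ1.ne' (Nat.eq_one_of_mul_eq_one_left hN)
      have hNR : (0 : ℝ) < N / 4 := by positivity
      rw [Real.logb_le_iff_le_rpow hℓR hNR, Real.rpow_natCast]
      linarith
    calc ((Real.logb ℓ ((N : ℝ) / 4) : ℝ) : EReal) ≤ ((k : ℝ) : EReal) :=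
          EReal.coe_le_coe_iff.2 (Nat.le_ceil _)
      _ = (((k : ℕ∞) : ℝ≥0∞) : EReal) := by
        rw [ENat.toENNReal_coe, ← ENNReal.coe_natCast, EReal.coe_nnreal_eq_coe_real, NNReal.coe_natCast]
      _ ≤ _ := by
        rw [EReal.coe_ennreal_le_coe_ennreal_iff, ENat.toENNReal_le]
        exact hgirth
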